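/- Let $\mathcal G_1,\mathcal G_2$ be isomorphic undirected weighted graphs on $\{1,\dots,n\}$ with symmetric, entrywise nonnegative adjacency matrices $A,B$; isomorphic means that $A=\Pi^\top B\Pi$ (equivalently $\|A-\Pi^\top B\Pi\|_F=0$) for some $\Pi$ in the set $\mathcal P$ of $n\times n$ permutation matrices. Assume that $\mathcal G_1$ is friendly (then so is $\mathcal G_2$, and both are asymmetric): the eigenvalues of $A$ are pairwise distinct and no eigenvector of $A$ is orthogonal to $\mathbf 1_n$. Let $a_i,b_i$ be the $i$-th columns of $A,B$. Let $\mathcal H$ be a connected undirected graph on $\{1,\dots,n\}$ (the agents) with weights $w_{ij}=w_{ji}$, where $w_{ij}>0$ if $ij$ is an edge and $w_{ij}=0$ otherwise. Put $\mathcal D_n=\{P\in\mathbb R^{n\times n}:P\mathbf 1_n=\mathbf 1_n\}$ and $\mathrm{Proj}_{\mathcal D_n}(V)=V(I_n-\frac1n\mathbf 1_n\mathbf 1_n^\top)$. Consider, for states $Q=(P_i,y_i,z_i,K_i,\lambda_i,\Theta_i,\Upsilon_i)_{i=1}^n$ with $P_i,K_i,\Theta_i,\Upsilon_i\in\mathbb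 R^{n\times n}$ and $y_i,z_i,\lambda_i\in\mathbb R^n$, the system on $t\ge 0$ $$\begin{aligned} \dot P_i&=\mathrm{Proj}_{\mathcal D_n}\Big\{-(P_ia_i-y_i)a_i^\top-b_i\lambda_i^\top-\sum_jw_{ij}(\Theta_i-\Theta_j)-\sum_jw_{ij}(P_i-P_j)-b_i(b_i^\top P_i-z_i^\top)\Big\},\\ \dot\lambda_i^\top&=b_i^\top P_i-z_i^\top,\qquad \dot\Theta_i=\sum_jw_{ij}(P_i-P_j),\qquad \dot K_i=\sum_jw_{ij}(\Upsilon_i-\Upsilon_j),\\ \dot\Upsilon_i&=[Y]_i-[Z]^i-\sum_jw_{ij}(K_i-K_j)-\sum_jw_{ij}(\Upsilon_i-\Upsilon_j),\\ \dot y_i&=(P_ia_i-y_i)-(\Upsilon_i)^{\mathrm C}_i,\qquad \dot z_i^\top=\lambda_i^\top+(\Upsilon_i)^{\mathrm R}_i+b_i^\top P_i-z_i^\top, \end{aligned}$$ where $[Y]_i$ is the matrix with $i$-th column $y_i$ and zeros elsewhere, $[Z]^i$ the matrix with $i$-th row $z_i^\top$ and zeros elsewhere, and $(\cdot)^{\mathrm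 C}_i,(\cdot)^{\mathrm R}_i$ denote the $i$-th column and row. Then there is exactly one $\Pi^*\in\mathcal P$ with $A=\Pi^{*\top}B\Pi^*$. For every initial condition $Q(0)$ with $P_i(0)\in\mathcal D_n$ for all $i$, a trajectory on $[0,\infty)$ exists, and every trajectory $Q(t)$ from $Q(0)$ converges, as $t\to\infty$, to an equilibrium of the system, with $P_i(t)\to\Pi^*$ for all $i$. Moreover, there is a finite time $T>0$ such that, for all $t\ge T$ and all $i$, $\|P_i(t)-\Pi^*\|_F<1/2$ and the projection of $P_i(t)$ onto $\mathcal P$ is $\Pi^*$; and at any time $t\ge0$ and for any $i$, $\|P_i(t)-\Pi^*\|_F<1/2$ implies that this projection is $\Pi^*$. Here "the projection is $\Pi^*$" means that $\Pi^*$ is the unique maximizer of $\mathrm{tr}(\Pi^\top P_i(t))$ over $\Pi\in\mathcal P$, and the unique element of $\mathcal P$ nearest to $P_i(t)$ in Frobenius norm. -/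

import Mathlib

open Set Filter Topology
open scoped Matrix

noncomputable section

namespace GraphMatching

/-! ### Matrices -/

/-- The Frobenius norm of a real square matrix. -/
def frob {n : ℕ} (M : Matrix (Fin n) (Fin n) ℝ) : ℝ :=
  Real.sqrt (∑ k, ∑ l, M k l ^ 2)

/-- The set of `n × n` permutation matrices: entries in `{0, 1}`, all row sums and
all column sums equal to one. -/
def permMatrices (n : ℕ) : Set (Matrix (Fin n) (Fin n) ℝ) :=
  {M | (∀ k l, M k l = 0 ∨ M k l = 1) ∧ M *ᵥ (fun _ => 1) = (fun _ => 1) ∧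
    Mᵀ *ᵥ (fun _ => 1) = (fun _ => 1)}

/-- The set of pseudo-stochastic matrices, `P 1 = 1`. -/
def pseudoStochastic (n : ℕ) : Set (Matrix (Fin n) (Fin n) ℝ) :=
  {M | M *ᵥ (fun _ => 1) = (fun _ => 1)}

/-- The projection `V ↦ V (I - (1/n) 1 1ᵀ)` of every row onto the hyperplane orthogonal to `1`. -/
def projD {n : ℕ} (V : Matrix (Fin n) (Fin n) ℝ) : Matrix (Fin n) (Fin n) ℝ :=
  V * (1 - (1 / (n : ℝ)) • Matrix.vecMulVec (fun _ => 1) (fun _ => 1))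

/-- The permutation matrices that maximize `tr (Mᵀ P)`. -/
def permProj {n : ℕ} (P : Matrix (Fin n) (Fin n) ℝ) : Set (Matrix (Fin n) (Fin n) ℝ) :=
  {M | M ∈ permMatrices n ∧
    ∀ N ∈ permMatrices n, Matrix.trace (Nᵀ * P) ≤ Matrix.trace (Mᵀ * P)}

/-- The permutation matrices that are nearest to `P` in the Frobenius norm. -/
def nearestPerm {n : ℕ} (P : Matrix (Fin n) (Fin n) ℝ) : Set (Matrix (Fin n) (Fin n) ℝ) :=
  {M | M ∈ permMatrices n ∧ ∀ N ∈ permMatrices n, frob (P - M) ≤ frob (P - N)}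

/-! ### Weighted graphs -/

/-- An undirected weighted graph on `{1, …, n}`, given by its symmetric adjacency matrix with
nonnegative entries. -/
structure WeightedGraph (n : ℕ) where
  /-- the adjacency matrix -/
  adj : Matrix (Fin n) (Fin n) ℝ
  symm : adj.IsSymm
  nonneg : ∀ i j, 0 ≤ adj i j

namespace WeightedGraph

variable {n : ℕ}

theorem isHermitian (G : WeightedGraph n) : G.adj.IsHermitian := by
  rw [Matrix.IsHermitian, Matrix.conjTranspose_eq_transpose_of_trivial]
  exact G.symm

/-- The distortion `‖A - Πᵀ B Π‖_F` of a matrix `M = Π` between two graphs. -/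
def dis (G₁ G₂ : WeightedGraph n) (M : Matrix (Fin n) (Fin n) ℝ) : ℝ :=
  frob (G₁.adj - Mᵀ * G₂.adj * M)

/-- The set of isomorphisms, i.e. permutation matrices of zero distortion. -/
def isoSet (G₁ G₂ : WeightedGraph n) : Set (Matrix (Fin n) (Fin n) ℝ) :=
  {M | M ∈ permMatrices n ∧ dis G₁ G₂ M = 0}

/-- Two graphs are isomorphic if some permutation matrix has zero distortion. -/
def Isomorphic (G₁ G₂ : WeightedGraph n) : Prop :=
  (isoSet G₁ G₂).Nonempty

/-- A graph is friendly if the eigenvalues of its adjacency matrix (listed with multiplicity)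
are distinct and no eigenvector is orthogonal to the all-ones vector. -/
def Friendly (G : WeightedGraph n) : Prop :=
  Function.Injective G.isHermitian.eigenvalues ∧
    ∀ (μ : ℝ) (u : Fin n → ℝ), u ≠ 0 → G.adj *ᵥ u = μ • u → u ⬝ᵥ (fun _ => 1) ≠ 0

end WeightedGraph

/-! ### The multi-agent network and its dynamics -/

/-- Symmetric weights on the interaction graph: positive on edges, zero off edges. -/
structure IsEdgeWeight {n : ℕ} (H : SimpleGraph (Fin n)) (w : Fin n → Fin n → ℝ) : Prop where
  symm : ∀ i j, w i j = w j i
  pos : ∀ i j, H.Adj i j → 0 < w i j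
  zero : ∀ i j, ¬ H.Adj i j → w i j = 0

/-- The state of the network; the index is the agent. -/
@[ext]
structure State (n : ℕ) where
  P : Fin n → Matrix (Fin n) (Fin n) ℝ
  y : Fin n → Fin n → ℝ
  z : Fin n → Fin n → ℝ
  K : Fin n → Matrix (Fin n) (Fin n) ℝ
  lam : Fin n → Fin n → ℝ
  Theta : Fin n → Matrix (Fin n) (Fin n) ℝ
  Ups : Fin n → Matrix (Fin n) (Fin n) ℝ

/-- The weighted disagreement `∑ⱼ wᵢⱼ (Xᵢ - Xⱼ)`. -/
def disagree {n : ℕ} (w : Fin n → Fin n → ℝ) (X : Fin n → Matrix (Fin n) (Fin n) ℝ)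
    (i : Fin n) : Matrix (Fin n) (Fin n) ℝ :=
  ∑ j, w i j • (X i - X j)

/-- The right-hand side of the projected primal-dual dynamics; agent `i` knows the `i`-th columns
of `A` and `B`, here `A.col i` and `B.col i`. -/
def field {n : ℕ} (A B : Matrix (Fin n) (Fin n) ℝ) (w : Fin n → Fin n → ℝ) (Q : State n) :
    State n where
  P i := projD
    (-Matrix.vecMulVec (Q.P i *ᵥ A.col i - Q.y i) (A.col i)
      - Matrix.vecMulVec (B.col i) (Q.lam i)
      - disagree w Q.Theta i
      - disagree w Q.P i
      - Matrix.vecMulVec (B.col i) (B.col i ᵥ* Q.P i - Q.z i))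
  y i := (Q.P i *ᵥ A.col i - Q.y i) - (Q.Ups i).col i
  z i := Q.lam i + (Q.Ups i).row i + (B.col i ᵥ* Q.P i - Q.z i)
  K i := disagree w Q.Ups i
  lam i := B.col i ᵥ* Q.P i - Q.z i
  Theta i := disagree w Q.P i
  Ups i := Matrix.updateCol 0 i (Q.y i) - Matrix.updateRow 0 i (Q.z i)
    - disagree w Q.K i - disagree w Q.Ups i

/-- `Q` solves the dynamics on `[0, ∞)` (entry by entry, one-sided derivative at time `0`). -/
structure IsTrajectory {n : ℕ} (A B : Matrix (Fin n) (Fin n) ℝ) (w : Fin n → Fin n → ℝ)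
    (Q : ℝ → State n) : Prop where
  P : ∀ t, 0 ≤ t → ∀ i k l,
    HasDerivWithinAt (fun s => (Q s).P i k l) ((field A B w (Q t)).P i k l) (Ici 0) t
  y : ∀ t, 0 ≤ t → ∀ i k,
    HasDerivWithinAt (fun s => (Q s).y i k) ((field A B w (Q t)).y i k) (Ici 0) t
  z : ∀ t, 0 ≤ t → ∀ i k,
    HasDerivWithinAt (fun s => (Q s).z i k) ((field A B w (Q t)).z i k) (Ici 0) t
  K : ∀ t, 0 ≤ t → ∀ i k l,
    HasDerivWithinAt (fun s => (Q s).K i k l) ((field A B w (Q t)).K i k l) (Ici 0) t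
  lam : ∀ t, 0 ≤ t → ∀ i k,
    HasDerivWithinAt (fun s => (Q s).lam i k) ((field A B w (Q t)).lam i k) (Ici 0) t
  Theta : ∀ t, 0 ≤ t → ∀ i k l,
    HasDerivWithinAt (fun s => (Q s).Theta i k l) ((field A B w (Q t)).Theta i k l) (Ici 0) t
  Ups : ∀ t, 0 ≤ t → ∀ i k l,
    HasDerivWithinAt (fun s => (Q s).Ups i k l) ((field A B w (Q t)).Ups i k l) (Ici 0) t

/-- `Q` is an equilibrium: the right-hand side of the dynamics vanishes there. -/
def IsEquilibrium {n : ℕ} (A B : Matrix (Fin n) (Fin n) ℝ) (w : Fin n → Fin n → ℝ)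
    (Q : State n) : Prop :=
  field A B w Q = ⟨0, 0, 0, 0, 0, 0, 0⟩

/-- All components of `Q t` converge to those of `R` as `t → ∞`. -/
structure ConvergesTo {n : ℕ} (Q : ℝ → State n) (R : State n) : Prop where
  P : Tendsto (fun t => (Q t).P) atTop (𝓝 R.P)
  y : Tendsto (fun t => (Q t).y) atTop (𝓝 R.y)
  z : Tendsto (fun t => (Q t).z) atTop (𝓝 R.z)
  K : Tendsto (fun t => (Q t).K) atTop (𝓝 R.K)
  lam : Tendsto (fun t => (Q t).lam) atTop (𝓝 R.lam)
  Theta : Tendsto (fun t => (Q t).Theta) atTop (𝓝 R.Theta)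
  Ups : Tendsto (fun t => (Q t).Ups) atTop (𝓝 R.Ups)

end GraphMatching

end

/-!
The dynamics is linear and splits into skew primal-dual couplings and a dissipative part. Fix an
isomorphism `M`. There is an equilibrium `Qe` with `Pᵢ = M` for all `i`: the `Υ` equation asks for
`K` whose image under the Laplacian of the connected interaction graph is a given family with sum
`M A - B M = 0` (`exists_disagree_eq`, `exists_isEquilibrium`). Row sums of the `Pᵢ` are conserved, so
`x = Q - Qe`
stays in the subspace `Pᵢ 1 = 0`, where it solves `x' = D x` with `⟨D x, x⟩ = -s(x) ≤ 0`, `s` being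
the sum of squares of the residuals `Pᵢaᵢ - yᵢ`, `bᵢᵀPᵢ - zᵢᵀ` and of the weighted disagreements of
the `Pᵢ` and of the `Υᵢ` (`inner_projField`).

For such a linear system a LaSalle argument (`exists_tendsto_of_dissipative`) gives convergence of
every trajectory to a point of `ker D`, provided that every `D`-invariant subspace on which `s`
vanishes lies in `ker D`. On such a subspace the velocities of `λ`, `Θ` and `K` vanish, and
following the remaining equations gives `D³ = 0`; since `D` is also skew there, `D = 0`
(`projField_cube_eq_zero`, `projField_eq_zero`).

At a limit `p ∈ ker D` the `Pᵢ` agree, and the sum of the `Υᵢ` equations becomes `P A = B P` with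
`P 1 = 0`. For an eigenvector `u` of `A`, the vector `Pᵀ M u` is then zero or an eigenvector of `A`
orthogonal to `1`, so friendliness forces `P = 0` (`Friendly.eq_zero_of_intertwine`). The same lemma,
applied to the difference of two isomorphisms, shows that `M` is unique. Finally, distinct
permutation matrices have Frobenius distance at least `1`, which makes `1 / 2` a safe radius for
rounding to `M` (`mdot_lt_mdot_of_frob_lt`).
-/

namespace GraphMatching

/-! ### Dissipative linear systems -/

section Dissipative

variable {E : Type*} [NormedAddCommGroup E] [InnerProductSpace ℝ E]

theorem norm_le_of_dissipative {D : E →L[ℝ] E} (hD : ∀ v, inner ℝ (D v) v ≤ 0) {x : ℝ → E}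
    (hx : ∀ t, 0 ≤ t → HasDerivWithinAt x (D (x t)) (Ici 0) t) {s t : ℝ} (hs : 0 ≤ s)
    (hst : s ≤ t) : ‖x t‖ ≤ ‖x s‖ := by
  have hderiv : ∀ r, 0 ≤ r →
      HasDerivWithinAt (fun r => ‖x r‖ ^ 2) (2 * inner ℝ (x r) (D (x r))) (Ici 0) r :=
    fun r hr => (hx r hr).norm_sq
  have hanti : AntitoneOn (fun r => ‖x r‖ ^ 2) (Ici (0 : ℝ)) := by
    refine antitoneOn_of_hasDerivWithinAt_nonpos (convex_Ici 0)
      (fun r hr => (hderiv r hr).continuousWithinAt)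
      (fun r hr => (hderiv r (interior_subset hr)).mono interior_subset) fun r _ => ?_
    have := hD (x r)
    rw [real_inner_comm] at this
    linarith
  exact le_of_sq_le_sq (hanti hs (hs.trans hst) hst) (norm_nonneg _)

theorem eq_of_dissipative {D : E →L[ℝ] E} (hD : ∀ v, inner ℝ (D v) v ≤ 0) {x y : ℝ → E}
    (hx : ∀ t, 0 ≤ t → HasDerivWithinAt x (D (x t)) (Ici 0) t)
    (hy : ∀ t, 0 ≤ t → HasDerivWithinAt y (D (y t)) (Ici 0) t) (h0 : x 0 = y 0) {t : ℝ}
    (ht : 0 ≤ t) : x t = y t := by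
  have hz : ∀ t, 0 ≤ t → HasDerivWithinAt (fun t => x t - y t) (D (x t - y t)) (Ici 0) t := by
    intro t ht
    rw [map_sub]
    exact (hx t ht).sub (hy t ht)
  have := norm_le_of_dissipative hD hz le_rfl ht
  simpa [h0, sub_eq_zero] using this

variable [CompleteSpace E]

theorem hasDerivAt_exp_apply (D : E →L[ℝ] E) (v : E) (t : ℝ) :
    HasDerivAt (fun s : ℝ => NormedSpace.exp (s • D) v) (D (NormedSpace.exp (t • D) v)) t := by
  have h := (hasDerivAt_exp_smul_const' (𝕂 := ℝ) D t).clm_apply (hasDerivAt_const t v)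
  simpa using h

theorem exists_hasDerivWithinAt (D : E →L[ℝ] E) (v : E) :
    ∃ x : ℝ → E, (∀ t, 0 ≤ t → HasDerivWithinAt x (D (x t)) (Ici 0) t) ∧ x 0 = v :=
  ⟨fun t => NormedSpace.exp (t • D) v, fun t _ => (hasDerivAt_exp_apply D v t).hasDerivWithinAt,
    by simp⟩

theorem exp_add_apply (D : E →L[ℝ] E) (v : E) (s t : ℝ) :
    NormedSpace.exp ((s + t) • D) v = NormedSpace.exp (s • D) (NormedSpace.exp (t • D) v) := by
  let _ : NormedAlgebra ℚ (E →L[ℝ] E) := NormedAlgebra.restrictScalars ℚ ℝ (E →L[ℝ] E)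
  rw [add_smul, NormedSpace.exp_add_of_commute
    (((Commute.refl D).smul_left s).smul_right t), mul_apply_eq_comp]

/-- The vectors whose trajectory under the flow of `D` never dissipates. -/
def nondissipative (D : E →L[ℝ] E) (hD : ∀ v, inner ℝ (D v) v ≤ 0) : Submodule ℝ E where
  carrier := {v | ∀ t : ℝ, 0 ≤ t →
    inner ℝ (D (NormedSpace.exp (t • D) v)) (NormedSpace.exp (t • D) v) = 0}
  zero_mem' := fun t _ => by simp
  smul_mem' := fun c v hv t ht => by
    simp only [map_smul, real_inner_smul_left, real_inner_smul_right, hv t ht, mul_zero]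
  add_mem' := fun {u v} hu hv t ht => by
    -- By the parallelogram identity the form vanishes at `u + v` and at `u - v`, being nonpositive.
    have h1 := hu t ht
    have h2 := hv t ht
    have h3 := hD (NormedSpace.exp (t • D) u + NormedSpace.exp (t • D) v)
    have h4 := hD (NormedSpace.exp (t • D) u - NormedSpace.exp (t • D) v)
    simp only [map_add, map_sub, inner_add_left, inner_add_right, inner_sub_left,
      inner_sub_right] at h1 h2 h3 h4 ⊢
    linarith

theorem exp_mem_nondissipative {D : E →L[ℝ] E} (hD : ∀ v, inner ℝ (D v) v ≤ 0) {v : E}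
    (hv : v ∈ nondissipative D hD) {t : ℝ} (ht : 0 ≤ t) :
    NormedSpace.exp (t • D) v ∈ nondissipative D hD := by
  intro s hs
  rw [← exp_add_apply]
  exact hv (s + t) (add_nonneg hs ht)

variable [FiniteDimensional ℝ E]

theorem apply_mem_nondissipative {D : E →L[ℝ] E} (hD : ∀ v, inner ℝ (D v) v ≤ 0) {v : E}
    (hv : v ∈ nondissipative D hD) : D v ∈ nondissipative D hD := by
  have hderiv : HasDerivWithinAt (fun s : ℝ => NormedSpace.exp (s • D) v) (D v) (Ioi 0) 0 := by
    simpa using (hasDerivAt_exp_apply D v 0).hasDerivWithinAt (s := Ioi 0)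
  rw [hasDerivWithinAt_iff_tendsto_slope' (by simp)] at hderiv
  refine (nondissipative D hD).closed_of_finiteDimensional.mem_of_tendsto hderiv ?_
  filter_upwards [self_mem_nhdsWithin] with t ht
  rw [slope_def_module]
  refine Submodule.smul_mem _ _ (Submodule.sub_mem _ ?_ ?_)
  · exact exp_mem_nondissipative hD hv (le_of_lt ht)
  · simpa using hv

/-- A LaSalle principle for linear systems. A limit point `p` of a trajectory has a trajectory of
constant norm, so it lies in the invariant subspace of nondissipative vectors and is an equilibrium;
the distance to an equilibrium is nonincreasing, so the whole trajectory converges to `p`. -/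
theorem exists_tendsto_of_dissipative {D : E →L[ℝ] E} (hD : ∀ v, inner ℝ (D v) v ≤ 0)
    (hN : ∀ N : Submodule ℝ E, (∀ v ∈ N, D v ∈ N) → (∀ v ∈ N, inner ℝ (D v) v = 0) →
      ∀ v ∈ N, D v = 0) {x : ℝ → E}
    (hx : ∀ t, 0 ≤ t → HasDerivWithinAt x (D (x t)) (Ici 0) t) :
    ∃ p, D p = 0 ∧ Tendsto x atTop (𝓝 p) := by
  have hflow : ∀ s t, 0 ≤ s → 0 ≤ t → x (t + s) = NormedSpace.exp (t • D) (x s) := by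
    intro s t hs ht
    refine eq_of_dissipative hD (x := fun t => x (t + s)) (fun r hr => ?_)
      (fun r _ => (hasDerivAt_exp_apply D (x s) r).hasDerivWithinAt) (by simp) ht
    have h := (hx (r + s) (add_nonneg hr hs)).scomp r
      (((hasDerivAt_id r).add_const s).hasDerivWithinAt (s := Ici 0))
      (fun q hq => add_nonneg (mem_Ici.1 hq) hs)
    simpa [Function.comp_def] using h
  obtain ⟨p, -, φ, hφ, hp⟩ := tendsto_subseq_of_bounded (x := fun k : ℕ => x k)
    (Metric.isBounded_closedBall (x := (0 : E)) (r := ‖x 0‖)) fun k => by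
      simpa using norm_le_of_dissipative hD hx le_rfl (Nat.cast_nonneg k)
  have hφ' : Tendsto (fun k => (φ k : ℝ)) atTop atTop :=
    tendsto_natCast_atTop_atTop.comp hφ.tendsto_atTop
  have hanti : Antitone fun t => ‖x (max t 0)‖ := fun s t hst =>
    norm_le_of_dissipative hD hx (le_max_right _ _) (max_le_max_right 0 hst)
  have hlim := tendsto_atTop_ciInf hanti ⟨0, by rintro _ ⟨t, rfl⟩; exact norm_nonneg _⟩
  set c := ⨅ t, ‖x (max t 0)‖
  have hconst : ∀ t : ℝ, 0 ≤ t → ‖NormedSpace.exp (t • D) p‖ = c := by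
    intro t ht
    have h1 : Tendsto (fun k => ‖NormedSpace.exp (t • D) (x (φ k))‖) atTop
        (𝓝 ‖NormedSpace.exp (t • D) p‖) :=
      (((NormedSpace.exp (t • D)).continuous.tendsto p).comp hp).norm
    have h2 := hlim.comp (tendsto_atTop_add_const_left _ t hφ')
    refine tendsto_nhds_unique h1 (h2.congr fun k => ?_)
    have hk : (0 : ℝ) ≤ φ k := Nat.cast_nonneg _
    simp only [Function.comp_apply]
    rw [max_eq_left (add_nonneg ht hk), hflow _ _ hk ht]
  have hpN : p ∈ nondissipative D hD := by
    intro t ht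
    have h1 := ((hasDerivAt_exp_apply D p t).hasDerivWithinAt (s := Ici 0)).norm_sq
    have h2 : HasDerivWithinAt (fun s : ℝ => ‖NormedSpace.exp (s • D) p‖ ^ 2) 0 (Ici 0) t :=
      (hasDerivWithinAt_const t (Ici 0) (c ^ 2)).congr
        (fun s hs => by rw [hconst s hs]) (by rw [hconst t ht])
    have h3 := (uniqueDiffOn_Ici (0 : ℝ) t ht).eq_deriv _ h1 h2
    rw [real_inner_comm]
    linarith
  have hDp : D p = 0 := hN (nondissipative D hD) (fun v => apply_mem_nondissipative hD)
    (fun v hv => by simpa using hv 0 le_rfl) p hpN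
  refine ⟨p, hDp, ?_⟩
  have hx' : ∀ t, 0 ≤ t → HasDerivWithinAt (fun t => x t - p) (D (x t - p)) (Ici 0) t := by
    intro t ht
    rw [map_sub, hDp, sub_zero]
    exact (hx t ht).sub_const p
  rw [Metric.tendsto_atTop]
  intro ε hε
  obtain ⟨k, hk⟩ := (Metric.tendsto_atTop.1 hp) ε hε
  refine ⟨φ k, fun t ht => ?_⟩
  rw [dist_eq_norm]
  refine (norm_le_of_dissipative hD hx' (Nat.cast_nonneg _) ht).trans_lt ?_
  have := hk k le_rfl
  rwa [dist_eq_norm] at this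

end Dissipative

/-! ### The Frobenius inner product -/

/-- The Frobenius inner product of two real matrices. -/
def mdot {n : ℕ} (X Y : Matrix (Fin n) (Fin n) ℝ) : ℝ :=
  ∑ k, ∑ l, X k l * Y k l

section Frobenius

variable {n : ℕ} (X Y Z : Matrix (Fin n) (Fin n) ℝ)

theorem mdot_comm : mdot X Y = mdot Y X := by
  simp only [mdot, mul_comm]

theorem mdot_add_left : mdot (X + Y) Z = mdot X Z + mdot Y Z := by
  simp only [mdot, Matrix.add_apply, add_mul, Finset.sum_add_distrib]

theorem mdot_smul_left (c : ℝ) : mdot (c • X) Y = c * mdot X Y := by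
  simp only [mdot, Matrix.smul_apply, smul_eq_mul, mul_assoc, Finset.mul_sum]

theorem mdot_neg_left : mdot (-X) Y = -mdot X Y := by
  simp only [mdot, Matrix.neg_apply, neg_mul, Finset.sum_neg_distrib]

theorem mdot_sub_left : mdot (X - Y) Z = mdot X Z - mdot Y Z := by
  rw [sub_eq_add_neg, mdot_add_left, mdot_neg_left, sub_eq_add_neg]

theorem mdot_sub_right : mdot X (Y - Z) = mdot X Y - mdot X Z := by
  rw [mdot_comm, mdot_sub_left, mdot_comm Y, mdot_comm Z]

theorem mdot_zero_left : mdot 0 X = 0 := by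
  simp [mdot]

theorem mdot_sum_left {ι : Type*} (s : Finset ι) (F : ι → Matrix (Fin n) (Fin n) ℝ) :
    mdot (∑ i ∈ s, F i) Y = ∑ i ∈ s, mdot (F i) Y := by
  classical
  induction s using Finset.induction_on with
  | empty => simp [mdot_zero_left]
  | insert a s ha ih => rw [Finset.sum_insert ha, Finset.sum_insert ha, mdot_add_left, ih]

theorem mdot_self_nonneg : 0 ≤ mdot X X :=
  Finset.sum_nonneg fun _ _ => Finset.sum_nonneg fun _ _ => mul_self_nonneg _

variable {X} in
theorem mdot_self_eq_zero : mdot X X = 0 ↔ X = 0 := by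
  refine ⟨fun h => ?_, fun h => by rw [h, mdot_zero_left]⟩
  ext k l
  have h1 := (Finset.sum_eq_zero_iff_of_nonneg
    (fun k _ => Finset.sum_nonneg fun l _ => mul_self_nonneg (X k l))).1 h k (Finset.mem_univ k)
  have h2 := (Finset.sum_eq_zero_iff_of_nonneg
    (fun l _ => mul_self_nonneg (X k l))).1 h1 l (Finset.mem_univ l)
  exact mul_self_eq_zero.1 h2

theorem mdot_eq_trace : mdot X Y = Matrix.trace (Xᵀ * Y) := by
  simp only [mdot, Matrix.trace, Matrix.diag_apply, Matrix.mul_apply, Matrix.transpose_apply]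
  exact Finset.sum_comm

theorem mdot_vecMulVec_left (u v : Fin n → ℝ) :
    mdot (Matrix.vecMulVec u v) X = u ⬝ᵥ (X *ᵥ v) := by
  simp only [mdot, Matrix.vecMulVec_apply, dotProduct, Matrix.mulVec, Finset.mul_sum]
  exact Finset.sum_congr rfl fun _ _ => Finset.sum_congr rfl fun _ _ => by ring

theorem mdot_updateCol_zero (i : Fin n) (u : Fin n → ℝ) :
    mdot (Matrix.updateCol 0 i u) X = u ⬝ᵥ X.col i := by
  simp [mdot, Matrix.updateCol_apply, dotProduct]

theorem mdot_updateRow_zero (i : Fin n) (u : Fin n → ℝ) :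
    mdot (Matrix.updateRow 0 i u) X = u ⬝ᵥ X.row i := by
  simp only [mdot, Matrix.updateRow_apply, dotProduct, Matrix.row_apply]
  rw [Finset.sum_eq_single i] <;> simp +contextual

theorem projD_add : projD (X + Y) = projD X + projD Y := Matrix.add_mul _ _ _

theorem projD_smul (c : ℝ) : projD (c • X) = c • projD X := Matrix.smul_mul _ _ _

theorem projD_zero : projD (0 : Matrix (Fin n) (Fin n) ℝ) = 0 := Matrix.zero_mul _

theorem mdot_projD : mdot (projD X) Y = mdot X (projD Y) := by
  have hS : (1 - (1 / (n : ℝ)) • Matrix.vecMulVec (fun _ : Fin n => (1 : ℝ)) (fun _ => 1))ᵀ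
      = 1 - (1 / (n : ℝ)) • Matrix.vecMulVec (fun _ : Fin n => (1 : ℝ)) (fun _ => 1) := by
    rw [Matrix.transpose_sub, Matrix.transpose_one, Matrix.transpose_smul,
      Matrix.transpose_vecMulVec]
  rw [mdot_eq_trace, mdot_eq_trace, projD, projD, Matrix.transpose_mul, hS, Matrix.mul_assoc,
    Matrix.trace_mul_comm, Matrix.mul_assoc]

theorem projD_mulVec_one : projD X *ᵥ (fun _ => 1) = 0 := by
  rcases Nat.eq_zero_or_pos n with rfl | hn
  · ext k; exact k.elim0
  have hn' : (n : ℝ) ≠ 0 := by positivity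
  rw [projD, ← Matrix.mulVec_mulVec]
  have h : (1 - (1 / (n : ℝ)) • Matrix.vecMulVec (fun _ : Fin n => (1 : ℝ)) (fun _ => 1) :
      Matrix (Fin n) (Fin n) ℝ) *ᵥ (fun _ => 1) = 0 := by
    ext k
    simp [Matrix.sub_mulVec, Matrix.smul_mulVec, Matrix.vecMulVec_mulVec, dotProduct, hn']
  rw [h, Matrix.mulVec_zero]

variable {X} in
theorem projD_eq_self (h : X *ᵥ (fun _ => 1) = 0) : projD X = X := by
  rw [projD, Matrix.mul_sub, Matrix.mul_one, Matrix.mul_smul, Matrix.mul_vecMulVec, h]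
  simp

theorem frob_nonneg : 0 ≤ frob X := Real.sqrt_nonneg _

theorem frob_sq : frob X ^ 2 = mdot X X := by
  rw [frob, Real.sq_sqrt (by positivity)]
  simp only [mdot, sq]

variable {X} in
theorem frob_eq_zero : frob X = 0 ↔ X = 0 := by
  rw [← mdot_self_eq_zero, ← frob_sq, sq_eq_zero_iff]

theorem mdot_le_frob_mul : mdot X Y ≤ frob X * frob Y := by
  have h := Finset.sum_mul_sq_le_sq_mul_sq (Finset.univ : Finset (Fin n × Fin n))
    (fun p => X p.1 p.2) (fun p => Y p.1 p.2)
  simp only [Fintype.sum_prod_type] at h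
  refine abs_le_of_sq_le_sq' ?_ (mul_nonneg (frob_nonneg X) (frob_nonneg Y)) |>.2
  rw [mul_pow, frob_sq, frob_sq]
  simpa only [mdot, sq] using h

end Frobenius

/-! ### Permutation matrices -/

section Permutation

variable {n : ℕ} {M N : Matrix (Fin n) (Fin n) ℝ}

theorem mul_transpose_of_mem_permMatrices (hM : M ∈ permMatrices n) : M * Mᵀ = 1 := by
  obtain ⟨h01, hrow, hcol⟩ := hM
  have hnn : ∀ k l, 0 ≤ M k l := fun k l => by rcases h01 k l with h | h <;> simp [h]
  ext k l
  rw [Matrix.mul_apply]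
  simp only [Matrix.transpose_apply]
  by_cases hkl : k = l
  · subst hkl
    rw [Matrix.one_apply_eq]
    have h := congrFun hrow k
    simp only [Matrix.mulVec, dotProduct, mul_one] at h
    rw [← h]
    exact Finset.sum_congr rfl fun m _ => by rcases h01 k m with h | h <;> simp [h]
  · rw [Matrix.one_apply_ne hkl]
    refine Finset.sum_eq_zero fun m _ => ?_
    have h := congrFun hcol m
    simp only [Matrix.mulVec, dotProduct, mul_one, Matrix.transpose_apply] at h
    have h2 : M k m + M l m ≤ ∑ q, M q m := by
      rw [← Finset.sum_pair (f := fun q => M q m) hkl]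
      exact Finset.sum_le_sum_of_subset_of_nonneg (Finset.subset_univ _) fun q _ _ => hnn q m
    rcases h01 k m with h3 | h3 <;> rcases h01 l m with h4 | h4 <;> simp only [h3, h4] at h2 ⊢ <;>
      linarith

theorem transpose_mul_of_mem_permMatrices (hM : M ∈ permMatrices n) : Mᵀ * M = 1 :=
  mul_eq_one_comm.1 (mul_transpose_of_mem_permMatrices hM)

theorem mdot_self_of_mem_permMatrices (hM : M ∈ permMatrices n) : mdot M M = n := by
  rw [mdot_eq_trace, transpose_mul_of_mem_permMatrices hM, Matrix.trace_one, Fintype.card_fin]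

theorem one_le_frob_sub (hM : M ∈ permMatrices n) (hN : N ∈ permMatrices n) (hne : M ≠ N) :
    1 ≤ frob (M - N) := by
  obtain ⟨k, l, hkl⟩ : ∃ k l, M k l ≠ N k l := by
    by_contra! h
    exact hne (Matrix.ext h)
  have h1 : 1 ≤ mdot (M - N) (M - N) := by
    calc (1 : ℝ) ≤ (M - N) k l * (M - N) k l := by
          rcases hM.1 k l with h | h <;> rcases hN.1 k l with h' | h' <;> simp_all
      _ ≤ ∑ q, (M - N) k q * (M - N) k q :=
          Finset.single_le_sum (f := fun q => (M - N) k q * (M - N) k q)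
            (fun q _ => mul_self_nonneg _) (Finset.mem_univ l)
      _ ≤ mdot (M - N) (M - N) :=
          Finset.single_le_sum (f := fun p => ∑ q, (M - N) p q * (M - N) p q)
            (fun p _ => Finset.sum_nonneg fun q _ => mul_self_nonneg _) (Finset.mem_univ k)
  rw [← frob_sq] at h1
  exact (one_le_sq_iff₀ (frob_nonneg _)).1 h1

/-- Two distinct permutation matrices are at distance `d ≥ 1`, and
`⟨M - N, M⟩ = d² / 2` because both have the same norm; a perturbation of `M` by less than `1/2`
changes `⟨M - N, ·⟩` by less than `d / 2`. -/
theorem mdot_lt_mdot_of_frob_lt {P : Matrix (Fin n) (Fin n) ℝ} (hM : M ∈ permMatrices n)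
    (hN : N ∈ permMatrices n) (hne : M ≠ N) (hP : frob (P - M) < 1 / 2) :
    mdot N P < mdot M P := by
  have hd := one_le_frob_sub hM hN hne
  have h1 := frob_sq (M - N)
  have h2 := mdot_le_frob_mul (N - M) (P - M)
  have h3 : frob (N - M) = frob (M - N) := by
    rw [← sq_eq_sq₀ (frob_nonneg _) (frob_nonneg _), frob_sq, frob_sq, ← neg_sub M N,
      mdot_neg_left, mdot_comm, mdot_neg_left, neg_neg]
  have hMM := mdot_self_of_mem_permMatrices hM
  have hNN := mdot_self_of_mem_permMatrices hN
  have hMN := mdot_comm M N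
  rw [h3] at h2
  simp only [mdot_sub_left, mdot_sub_right] at h1 h2
  nlinarith [frob_nonneg (P - M)]

theorem permProj_eq_singleton {P : Matrix (Fin n) (Fin n) ℝ} (hM : M ∈ permMatrices n)
    (hP : frob (P - M) < 1 / 2) : permProj P = {M} := by
  have key : ∀ N ∈ permMatrices n, N ≠ M → Matrix.trace (Nᵀ * P) < Matrix.trace (Mᵀ * P) :=
    fun N hN hne => by
      simpa only [mdot_eq_trace] using mdot_lt_mdot_of_frob_lt hM hN hne.symm hP
  ext N
  refine ⟨fun hN => by_contra fun hne => absurd (hN.2 M hM) (key N hN.1 hne).not_ge, ?_⟩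
  rintro rfl
  refine ⟨hM, fun K hK => ?_⟩
  by_cases h : K = N
  · rw [h]
  · exact (key K hK h).le

theorem nearestPerm_eq_permProj (P : Matrix (Fin n) (Fin n) ℝ) : nearestPerm P = permProj P := by
  have key : ∀ M ∈ permMatrices n, ∀ N ∈ permMatrices n,
      frob (P - M) ≤ frob (P - N) ↔ Matrix.trace (Nᵀ * P) ≤ Matrix.trace (Mᵀ * P) := by
    intro M hM N hN
    rw [← sq_le_sq₀ (frob_nonneg _) (frob_nonneg _), frob_sq, frob_sq, ← mdot_eq_trace,
      ← mdot_eq_trace]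
    have hMM := mdot_self_of_mem_permMatrices hM
    have hNN := mdot_self_of_mem_permMatrices hN
    simp only [mdot_sub_left, mdot_sub_right, mdot_comm P]
    constructor <;> intro h <;> linarith
  ext M
  exact and_congr_right fun hM => forall₂_congr fun N hN => key M hM N hN

end Permutation

/-! ### Friendly graphs -/

namespace WeightedGraph

variable {n : ℕ} {G₁ G₂ : WeightedGraph n} {M : Matrix (Fin n) (Fin n) ℝ}

theorem mul_adj_of_mem_isoSet (hM : M ∈ isoSet G₁ G₂) : M * G₁.adj = G₂.adj * M := by
  have h : G₁.adj = Mᵀ * G₂.adj * M := sub_eq_zero.1 (frob_eq_zero.1 hM.2)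
  rw [h, ← Matrix.mul_assoc, ← Matrix.mul_assoc, mul_transpose_of_mem_permMatrices hM.1,
    Matrix.one_mul]

/-- If `M` is an isomorphism and `u` an eigenvector of the first adjacency matrix `A`, then
`v = Xᵀ M u` satisfies `A v = μ v` and is orthogonal to the all-ones vector, so friendliness
gives `v = 0`. As `u` runs through an eigenbasis, `X` vanishes. -/
theorem Friendly.eq_zero_of_intertwine (hf : G₁.Friendly) (hM : M ∈ isoSet G₁ G₂)
    {X : Matrix (Fin n) (Fin n) ℝ} (hX : X * G₁.adj = G₂.adj * X) (hX1 : X *ᵥ (fun _ => 1) = 0) :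
    X = 0 := by
  have hMA := mul_adj_of_mem_isoSet hM
  have hcomm : G₁.adj * (Xᵀ * M) = (Xᵀ * M) * G₁.adj := by
    have h := congrArg Matrix.transpose hX
    rw [Matrix.transpose_mul, Matrix.transpose_mul, G₁.symm.eq, G₂.symm.eq] at h
    rw [← Matrix.mul_assoc, h, Matrix.mul_assoc, Matrix.mul_assoc, hMA]
  have hzero : ∀ k, (Xᵀ * M) *ᵥ (G₁.isHermitian.eigenvectorBasis k).ofLp = 0 := by
    intro k
    by_contra hne
    refine hf.2 (G₁.isHermitian.eigenvalues k) _ hne ?_ ?_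
    · rw [Matrix.mulVec_mulVec, hcomm, ← Matrix.mulVec_mulVec,
        G₁.isHermitian.mulVec_eigenvectorBasis, Matrix.mulVec_smul]
    · rw [← Matrix.mulVec_mulVec, Matrix.mulVec_transpose, ← Matrix.dotProduct_mulVec, hX1,
        dotProduct_zero]
  have hXM : Xᵀ * M = 0 := by
    have h : Matrix.toEuclideanLin (Xᵀ * M) = 0 := by
      refine G₁.isHermitian.eigenvectorBasis.toBasis.ext fun k => ?_
      rw [OrthonormalBasis.coe_toBasis, Matrix.toLpLin_apply, hzero k]
      rfl
    exact (LinearEquiv.map_eq_zero_iff _).1 h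
  have h := congrArg (· * Mᵀ) hXM
  simp only [Matrix.mul_assoc, mul_transpose_of_mem_permMatrices hM.1, Matrix.mul_one,
    Matrix.zero_mul] at h
  exact Matrix.transpose_eq_zero.1 h

theorem Friendly.isoSet_eq_singleton (hf : G₁.Friendly) (hM : M ∈ isoSet G₁ G₂) :
    isoSet G₁ G₂ = {M} := by
  refine Set.eq_singleton_iff_unique_mem.2 ⟨hM, fun N hN => sub_eq_zero.1 ?_⟩
  refine hf.eq_zero_of_intertwine hM ?_ ?_
  · rw [Matrix.sub_mul, Matrix.mul_sub, mul_adj_of_mem_isoSet hN, mul_adj_of_mem_isoSet hM]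
  · rw [Matrix.sub_mulVec, hN.1.2.1, hM.1.2.1, sub_self]

end WeightedGraph

/-! ### The Laplacian of the interaction graph -/

section Laplacian

variable {n : ℕ} {H : SimpleGraph (Fin n)} {w : Fin n → Fin n → ℝ}
  (X Y : Fin n → Matrix (Fin n) (Fin n) ℝ)

theorem disagree_add : disagree w (X + Y) = disagree w X + disagree w Y := by
  ext1 i
  simp only [disagree, Pi.add_apply, ← Finset.sum_add_distrib, ← smul_add]
  exact Finset.sum_congr rfl fun j _ => by rw [add_sub_add_comm]

theorem disagree_smul (c : ℝ) : disagree w (c • X) = c • disagree w X := by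
  ext1 i
  simp only [disagree, Pi.smul_apply, Finset.smul_sum, ← smul_sub]
  exact Finset.sum_congr rfl fun j _ => smul_comm _ _ _

theorem disagree_zero : disagree w 0 = 0 := by
  ext1 i
  simp [disagree]

theorem disagree_const (C : Matrix (Fin n) (Fin n) ℝ) : disagree w (fun _ => C) = 0 := by
  ext1 i
  simp [disagree]

variable (hw : IsEdgeWeight H w)
include hw

theorem sum_disagree : ∑ i, disagree w X i = 0 := by
  simp only [disagree, smul_sub, Finset.sum_sub_distrib]
  rw [Finset.sum_comm, sub_eq_zero]
  exact Finset.sum_congr rfl fun i _ => Finset.sum_congr rfl fun j _ => by rw [hw.symm]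

theorem sum_mdot_disagree :
    ∑ i, mdot (disagree w X i) (Y i)
      = (∑ i, ∑ j, w i j * mdot (X i - X j) (Y i - Y j)) / 2 := by
  have h1 : ∑ i, mdot (disagree w X i) (Y i) = ∑ i, ∑ j, w i j * mdot (X i - X j) (Y i) := by
    simp only [disagree, mdot_sum_left, mdot_smul_left]
  have h2 : ∑ i, ∑ j, w i j * mdot (X i - X j) (Y j)
      = -∑ i, ∑ j, w i j * mdot (X i - X j) (Y i) := by
    rw [Finset.sum_comm, ← Finset.sum_neg_distrib]
    refine Finset.sum_congr rfl fun i _ => ?_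
    rw [← Finset.sum_neg_distrib]
    refine Finset.sum_congr rfl fun j _ => ?_
    rw [hw.symm j i, ← neg_sub (X i) (X j), mdot_neg_left]
    ring
  simp only [mdot_sub_right, mul_sub, Finset.sum_sub_distrib, h2]
  rw [h1]
  ring

theorem sum_mdot_disagree_comm :
    ∑ i, mdot (disagree w X i) (Y i) = ∑ i, mdot (disagree w Y i) (X i) := by
  rw [sum_mdot_disagree _ _ hw, sum_mdot_disagree _ _ hw]
  simp only [mdot_comm]

theorem IsEdgeWeight.nonneg (i j : Fin n) : 0 ≤ w i j := by
  by_cases h : H.Adj i j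
  · exact (hw.pos i j h).le
  · exact (hw.zero i j h).ge

theorem sum_mdot_disagree_self_nonneg : 0 ≤ ∑ i, mdot (disagree w X i) (X i) := by
  rw [sum_mdot_disagree _ _ hw]
  exact div_nonneg (Finset.sum_nonneg fun i _ => Finset.sum_nonneg fun j _ =>
    mul_nonneg (hw.nonneg i j) (mdot_self_nonneg _)) zero_le_two

theorem weight_smul_sub_eq_zero (h : ∑ i, mdot (disagree w X i) (X i) = 0) (i j : Fin n) :
    w i j • (X i - X j) = 0 := by
  have hnn : ∀ i j, 0 ≤ w i j * mdot (X i - X j) (X i - X j) := fun i j =>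
    mul_nonneg (hw.nonneg i j) (mdot_self_nonneg _)
  rw [sum_mdot_disagree _ _ hw, div_eq_zero_iff, or_iff_left two_ne_zero] at h
  have h1 := (Finset.sum_eq_zero_iff_of_nonneg
    (fun i _ => Finset.sum_nonneg fun j _ => hnn i j)).1 h i (Finset.mem_univ i)
  have h2 := (Finset.sum_eq_zero_iff_of_nonneg (fun j _ => hnn i j)).1 h1 j (Finset.mem_univ j)
  rcases mul_eq_zero.1 h2 with h3 | h3
  · rw [h3, zero_smul]
  · rw [mdot_self_eq_zero.1 h3, smul_zero]

theorem disagree_eq_zero (h : ∑ i, mdot (disagree w X i) (X i) = 0) : disagree w X = 0 := by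
  ext1 i
  exact Finset.sum_eq_zero fun j _ => weight_smul_sub_eq_zero X hw h i j

theorem eq_of_disagree_eq_zero (hH : H.Connected) (h : disagree w X = 0) (i j : Fin n) :
    X i = X j := by
  have h0 : ∑ i, mdot (disagree w X i) (X i) = 0 := by
    simp [h, mdot_zero_left]
  obtain ⟨p⟩ := hH.preconnected i j
  induction p with
  | nil => rfl
  | @cons a b _ hadj _ ih =>
    refine Eq.trans ?_ ih
    have h1 := weight_smul_sub_eq_zero X hw h0 a b
    exact sub_eq_zero.1 ((smul_eq_zero.1 h1).resolve_left (hw.pos _ _ hadj).ne')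

/-- The Laplacian of a connected graph maps onto the families of zero sum: adding the sum of the
family to the Laplacian gives an injective, hence surjective, endomorphism. -/
theorem exists_disagree_eq (hH : H.Connected) (C : Fin n → Matrix (Fin n) (Fin n) ℝ)
    (hC : ∑ i, C i = 0) : ∃ X, disagree w X = C := by
  have : Nonempty (Fin n) := hH.nonempty
  have hn : (n : ℝ) ≠ 0 := by
    have := Fintype.card_ne_zero (α := Fin n)
    rw [Fintype.card_fin] at this
    exact_mod_cast this
  let T : (Fin n → Matrix (Fin n) (Fin n) ℝ) →ₗ[ℝ] (Fin n → Matrix (Fin n) (Fin n) ℝ) :=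
    { toFun := fun X => disagree w X + fun _ => ∑ j, X j
      map_add' := fun X Y => by
        rw [disagree_add]
        ext1 i
        simp only [Pi.add_apply, Finset.sum_add_distrib]
        abel
      map_smul' := fun c X => by
        rw [disagree_smul]
        ext1 i
        simp only [Pi.add_apply, Pi.smul_apply, Finset.smul_sum, smul_add, RingHom.id_apply] }
  have hT : ∀ X i, T X i = disagree w X i + ∑ j, X j := fun _ _ => rfl
  have hsum : ∀ X, ∑ i, T X i = 0 → ∑ j, X j = 0 := by
    intro X hX
    simp only [hT, Finset.sum_add_distrib, sum_disagree X hw, zero_add, Finset.sum_const,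
      Finset.card_univ, Fintype.card_fin] at hX
    rw [← Nat.cast_smul_eq_nsmul ℝ] at hX
    exact (smul_eq_zero.1 hX).resolve_left hn
  have hinj : Function.Injective T := by
    refine (injective_iff_map_eq_zero T).2 fun X hX => ?_
    have h0 : ∑ j, X j = 0 := hsum X (by simp [hX])
    have hdis : disagree w X = 0 := by
      ext1 i
      have := congrFun hX i
      rwa [hT, h0, add_zero] at this
    ext1 i
    have h1 : ∑ j, X j = ∑ _j : Fin n, X i :=
      Finset.sum_congr rfl fun j _ => eq_of_disagree_eq_zero X hw hH hdis j i
    rw [h0, Finset.sum_const, Finset.card_univ, Fintype.card_fin,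
      ← Nat.cast_smul_eq_nsmul ℝ] at h1
    exact (smul_eq_zero.1 h1.symm).resolve_left hn
  obtain ⟨X, hX⟩ := LinearMap.injective_iff_surjective.1 hinj C
  refine ⟨X, ?_⟩
  ext1 i
  have := congrFun hX i
  rwa [hT, hsum X (by rw [hX, hC]), add_zero] at this

end Laplacian

/-! ### The state space as an inner product space -/

section StateSpace

variable {n : ℕ}

/-- States as tuples of their seven components. -/
def stateEquiv (n : ℕ) : State n ≃
    (Fin n → Fin n → Fin n → ℝ) × (Fin n → Fin n → ℝ) × (Fin n → Fin n → ℝ) ×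
    (Fin n → Fin n → Fin n → ℝ) × (Fin n → Fin n → ℝ) × (Fin n → Fin n → Fin n → ℝ) ×
    (Fin n → Fin n → Fin n → ℝ) where
  toFun Q := (Q.P, Q.y, Q.z, Q.K, Q.lam, Q.Theta, Q.Ups)
  invFun v := ⟨v.1, v.2.1, v.2.2.1, v.2.2.2.1, v.2.2.2.2.1, v.2.2.2.2.2.1, v.2.2.2.2.2.2⟩

noncomputable instance : AddCommGroup (State n) := (stateEquiv n).addCommGroup

noncomputable instance : Module ℝ (State n) := (stateEquiv n).module ℝ

variable (Q R : State n) (c : ℝ)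

@[simp] theorem State.add_P : (Q + R).P = Q.P + R.P := rfl
@[simp] theorem State.add_y : (Q + R).y = Q.y + R.y := rfl
@[simp] theorem State.add_z : (Q + R).z = Q.z + R.z := rfl
@[simp] theorem State.add_K : (Q + R).K = Q.K + R.K := rfl
@[simp] theorem State.add_lam : (Q + R).lam = Q.lam + R.lam := rfl
@[simp] theorem State.add_Theta : (Q + R).Theta = Q.Theta + R.Theta := rfl
@[simp] theorem State.add_Ups : (Q + R).Ups = Q.Ups + R.Ups := rfl
@[simp] theorem State.smul_P : (c • Q).P = c • Q.P := rfl
@[simp] theorem State.smul_y : (c • Q).y = c • Q.y := rfl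
@[simp] theorem State.smul_z : (c • Q).z = c • Q.z := rfl
@[simp] theorem State.smul_K : (c • Q).K = c • Q.K := rfl
@[simp] theorem State.smul_lam : (c • Q).lam = c • Q.lam := rfl
@[simp] theorem State.smul_Theta : (c • Q).Theta = c • Q.Theta := rfl
@[simp] theorem State.smul_Ups : (c • Q).Ups = c • Q.Ups := rfl
@[simp] theorem State.zero_Ups : (0 : State n).Ups = 0 := rfl
@[simp] theorem State.sub_P : (Q - R).P = Q.P - R.P := rfl

/-- The sum over all agents and components of the Euclidean inner products. -/
def stateInner (Q R : State n) : ℝ :=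
  ∑ i, (mdot (Q.P i) (R.P i) + Q.y i ⬝ᵥ R.y i + Q.z i ⬝ᵥ R.z i + mdot (Q.K i) (R.K i)
    + Q.lam i ⬝ᵥ R.lam i + mdot (Q.Theta i) (R.Theta i) + mdot (Q.Ups i) (R.Ups i))

theorem dotProduct_self_nonneg_real (u : Fin n → ℝ) : 0 ≤ u ⬝ᵥ u :=
  Finset.sum_nonneg fun _ _ => mul_self_nonneg _

/-- The Euclidean inner product space structure on the states. -/
@[reducible]
noncomputable def stateCore (n : ℕ) : InnerProductSpace.Core ℝ (State n) where
  inner := stateInner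
  conj_inner_symm Q R := by
    simp only [stateInner, mdot_comm, dotProduct_comm, conj_trivial]
  re_inner_nonneg Q := by
    change 0 ≤ stateInner Q Q
    refine Finset.sum_nonneg fun i _ => ?_
    have := mdot_self_nonneg (Q.P i)
    have := mdot_self_nonneg (Q.K i)
    have := mdot_self_nonneg (Q.Theta i)
    have := mdot_self_nonneg (Q.Ups i)
    have := dotProduct_self_nonneg_real (Q.y i)
    have := dotProduct_self_nonneg_real (Q.z i)
    have := dotProduct_self_nonneg_real (Q.lam i)
    positivity
  add_left Q R S := by
    simp only [stateInner, ← Finset.sum_add_distrib]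
    refine Finset.sum_congr rfl fun i _ => ?_
    simp only [State.add_P, State.add_y, State.add_z, State.add_K, State.add_lam,
      State.add_Theta, State.add_Ups, Pi.add_apply, mdot_add_left, add_dotProduct]
    ring
  smul_left Q R c := by
    simp only [stateInner, Finset.mul_sum]
    refine Finset.sum_congr rfl fun i _ => ?_
    simp only [State.smul_P, State.smul_y, State.smul_z, State.smul_K, State.smul_lam,
      State.smul_Theta, State.smul_Ups, Pi.smul_apply, mdot_smul_left, smul_dotProduct,
      smul_eq_mul, conj_trivial]
    ring
  definite Q h := by
    have hP := fun i => mdot_self_nonneg (Q.P i)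
    have hK := fun i => mdot_self_nonneg (Q.K i)
    have hT := fun i => mdot_self_nonneg (Q.Theta i)
    have hU := fun i => mdot_self_nonneg (Q.Ups i)
    have hy := fun i => dotProduct_self_nonneg_real (Q.y i)
    have hz := fun i => dotProduct_self_nonneg_real (Q.z i)
    have hl := fun i => dotProduct_self_nonneg_real (Q.lam i)
    have h' := fun i => (Finset.sum_eq_zero_iff_of_nonneg (fun i _ => by
      linarith [hP i, hK i, hT i, hU i, hy i, hz i, hl i])).1 h i (Finset.mem_univ i)
    ext1 <;> ext1 i <;> specialize h' i <;> specialize hP i <;> specialize hK i <;>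
      specialize hT i <;> specialize hU i <;> specialize hy i <;> specialize hz i <;>
      specialize hl i
    · exact mdot_self_eq_zero.1 (by linarith)
    · exact dotProduct_self_eq_zero.1 (by linarith)
    · exact dotProduct_self_eq_zero.1 (by linarith)
    · exact mdot_self_eq_zero.1 (by linarith)
    · exact dotProduct_self_eq_zero.1 (by linarith)
    · exact mdot_self_eq_zero.1 (by linarith)
    · exact mdot_self_eq_zero.1 (by linarith)

noncomputable instance : NormedAddCommGroup (State n) := (stateCore n).toNormedAddCommGroup

noncomputable instance : InnerProductSpace ℝ (State n) := .ofCore (stateCore n).toCore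

theorem inner_state : inner ℝ Q R = stateInner Q R := rfl

/-- `stateEquiv` as a linear equivalence. -/
noncomputable def stateLinearEquiv (n : ℕ) : State n ≃ₗ[ℝ]
    (Fin n → Fin n → Fin n → ℝ) × (Fin n → Fin n → ℝ) × (Fin n → Fin n → ℝ) ×
    (Fin n → Fin n → Fin n → ℝ) × (Fin n → Fin n → ℝ) × (Fin n → Fin n → Fin n → ℝ) ×
    (Fin n → Fin n → Fin n → ℝ) :=
  { stateEquiv n with
    map_add' := fun _ _ => rfl
    map_smul' := fun _ _ => rfl }

instance : FiniteDimensional ℝ (State n) := (stateLinearEquiv n).symm.finiteDimensional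

instance : CompleteSpace (State n) := FiniteDimensional.complete ℝ _

/-- `stateEquiv` as a continuous linear equivalence. -/
noncomputable def stateCLE (n : ℕ) := (stateLinearEquiv n).toContinuousLinearEquiv

theorem convergesTo_of_tendsto {Q : ℝ → State n} {R : State n} (h : Tendsto Q atTop (𝓝 R)) :
    ConvergesTo Q R := by
  have h' := ((stateCLE n).continuous.tendsto R).comp h
  exact ⟨h'.fst_nhds, h'.snd_nhds.fst_nhds, h'.snd_nhds.snd_nhds.fst_nhds,
    h'.snd_nhds.snd_nhds.snd_nhds.fst_nhds, h'.snd_nhds.snd_nhds.snd_nhds.snd_nhds.fst_nhds,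
    h'.snd_nhds.snd_nhds.snd_nhds.snd_nhds.snd_nhds.fst_nhds,
    h'.snd_nhds.snd_nhds.snd_nhds.snd_nhds.snd_nhds.snd_nhds⟩

theorem hasDerivWithinAt_family {F : ℝ → Fin n → Fin n → Fin n → ℝ} {F' : Fin n → Fin n → Fin n → ℝ}
    {s : Set ℝ} {t : ℝ}
    (h : ∀ i k l, HasDerivWithinAt (fun r => F r i k l) (F' i k l) s t) :
    HasDerivWithinAt F F' s t :=
  hasDerivWithinAt_pi.2 fun i => hasDerivWithinAt_pi.2 fun k => hasDerivWithinAt_pi.2 (h i k)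

theorem isTrajectory_iff {A B : Matrix (Fin n) (Fin n) ℝ} {w : Fin n → Fin n → ℝ}
    {Q : ℝ → State n} : IsTrajectory A B w Q ↔
      ∀ t, 0 ≤ t → HasDerivWithinAt Q (field A B w (Q t)) (Ici 0) t := by
  constructor
  · intro h t ht
    have key : HasDerivWithinAt (fun s => stateCLE n (Q s)) (stateCLE n (field A B w (Q t)))
        (Ici 0) t := by
      refine HasDerivWithinAt.prodMk ?_ (HasDerivWithinAt.prodMk ?_ (HasDerivWithinAt.prodMk ?_
        (HasDerivWithinAt.prodMk ?_ (HasDerivWithinAt.prodMk ?_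
        (HasDerivWithinAt.prodMk ?_ ?_)))))
      · exact hasDerivWithinAt_family (h.P t ht)
      · exact hasDerivWithinAt_pi.2 fun i => hasDerivWithinAt_pi.2 fun k => h.y t ht i k
      · exact hasDerivWithinAt_pi.2 fun i => hasDerivWithinAt_pi.2 fun k => h.z t ht i k
      · exact hasDerivWithinAt_family (h.K t ht)
      · exact hasDerivWithinAt_pi.2 fun i => hasDerivWithinAt_pi.2 fun k => h.lam t ht i k
      · exact hasDerivWithinAt_family (h.Theta t ht)
      · exact hasDerivWithinAt_family (h.Ups t ht)
    have h2 := (stateCLE n).symm.hasFDerivAt.comp_hasDerivWithinAt t key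
    simpa [Function.comp_def] using h2
  · intro h
    -- Every linear coordinate of the state inherits the derivative.
    have key : ∀ (ℓ : State n →ₗ[ℝ] ℝ) (t : ℝ), 0 ≤ t →
        HasDerivWithinAt (fun s => ℓ (Q s)) (ℓ (field A B w (Q t))) (Ici 0) t := fun ℓ t ht =>
      (LinearMap.toContinuousLinearMap ℓ).hasFDerivAt.comp_hasDerivWithinAt t (h t ht)
    exact
      { P := fun t ht i k l => key ⟨⟨fun Q => Q.P i k l, fun _ _ => rfl⟩, fun _ _ => rfl⟩ t ht
        y := fun t ht i k => key ⟨⟨fun Q => Q.y i k, fun _ _ => rfl⟩, fun _ _ => rfl⟩ t ht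
        z := fun t ht i k => key ⟨⟨fun Q => Q.z i k, fun _ _ => rfl⟩, fun _ _ => rfl⟩ t ht
        K := fun t ht i k l => key ⟨⟨fun Q => Q.K i k l, fun _ _ => rfl⟩, fun _ _ => rfl⟩ t ht
        lam := fun t ht i k => key ⟨⟨fun Q => Q.lam i k, fun _ _ => rfl⟩, fun _ _ => rfl⟩ t ht
        Theta := fun t ht i k l =>
          key ⟨⟨fun Q => Q.Theta i k l, fun _ _ => rfl⟩, fun _ _ => rfl⟩ t ht
        Ups := fun t ht i k l =>
          key ⟨⟨fun Q => Q.Ups i k l, fun _ _ => rfl⟩, fun _ _ => rfl⟩ t ht }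

end StateSpace

/-! ### Dissipativity of the dynamics -/

section Dynamics

variable {n : ℕ} (A B : Matrix (Fin n) (Fin n) ℝ) (w : Fin n → Fin n → ℝ)

/-- The right-hand side of the dynamics as a linear map. -/
noncomputable def fieldLin : State n →ₗ[ℝ] State n where
  toFun := field A B w
  map_add' Q R := by
    ext1 <;> ext1 i
    · simp only [field, State.add_P, State.add_y, State.add_z, State.add_lam, State.add_Theta,
        disagree_add, Pi.add_apply, ← projD_add, Matrix.add_mulVec, Matrix.vecMul_add]
      congr 1
      ext k l
      simp only [Matrix.vecMulVec_apply, Matrix.add_apply, Matrix.sub_apply, Matrix.neg_apply,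
        Pi.add_apply, Pi.sub_apply]
      ring
    · ext k
      simp [field, Matrix.add_mulVec]
      ring
    · ext k
      simp [field, Matrix.vecMul_add]
      ring
    · simp [field, disagree_add]
    · ext k
      simp [field, Matrix.vecMul_add]
      ring
    · simp [field, disagree_add]
    · ext k l
      simp [field, disagree_add, Matrix.updateCol_apply, Matrix.updateRow_apply]
      split_ifs <;> ring
  map_smul' c Q := by
    ext1 <;> ext1 i
    · simp only [field, State.smul_P, State.smul_y, State.smul_z, State.smul_lam,
        State.smul_Theta, disagree_smul, Pi.smul_apply, ← projD_smul, Matrix.smul_mulVec,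
        Matrix.vecMul_smul, RingHom.id_apply]
      congr 1
      ext k l
      simp only [Matrix.vecMulVec_apply, Matrix.smul_apply, Matrix.sub_apply, Matrix.neg_apply,
        Pi.smul_apply, Pi.sub_apply, smul_eq_mul]
      ring
    · ext k
      simp [field, Matrix.smul_mulVec]
      ring
    · ext k
      simp [field, Matrix.vecMul_smul]
      ring
    · simp [field, disagree_smul]
    · ext k
      simp [field, Matrix.vecMul_smul]
      ring
    · simp [field, disagree_smul]
    · ext k l
      simp [field, disagree_smul, Matrix.updateCol_apply, Matrix.updateRow_apply]
      split_ifs <;> ring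

theorem fieldLin_apply (Q : State n) : fieldLin A B w Q = field A B w Q := rfl

/-- The projection of the components `Pᵢ` onto the matrices with zero row sums. -/
noncomputable def projState : State n →ₗ[ℝ] State n where
  toFun Q := { Q with P := fun i => projD (Q.P i) }
  map_add' Q R := by
    ext1 <;> ext1 i <;> simp [projD_add]
  map_smul' c Q := by
    ext1 <;> ext1 i <;> simp [projD_smul]

theorem projState_eq_self {Q : State n} (h : ∀ i, Q.P i *ᵥ (fun _ => 1) = 0) :
    projState Q = Q := by
  ext1
  · ext1 i
    exact projD_eq_self (h i)
  all_goals rfl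

/-- The dynamics after projection of the `Pᵢ`. It has the same trajectories with `Pᵢ 1 = 0`, and it
is dissipative on the whole state space. -/
noncomputable def projField : State n →L[ℝ] State n :=
  LinearMap.toContinuousLinearMap (fieldLin A B w ∘ₗ projState)

theorem projField_apply (Q : State n) : projField A B w Q = field A B w (projState Q) := rfl

/-- The dissipation rate: the fidelity residuals `Pᵢaᵢ - yᵢ`, `bᵢᵀPᵢ - zᵢᵀ` and the disagreements
among the `Pᵢ` and among the `Υᵢ`. -/
def dissipation (Q : State n) : ℝ :=
  ∑ i, ((Q.P i *ᵥ A.col i - Q.y i) ⬝ᵥ (Q.P i *ᵥ A.col i - Q.y i)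
      + (B.col i ᵥ* Q.P i - Q.z i) ⬝ᵥ (B.col i ᵥ* Q.P i - Q.z i))
    + ∑ i, mdot (disagree w Q.P i) (Q.P i) + ∑ i, mdot (disagree w Q.Ups i) (Q.Ups i)

variable {H : SimpleGraph (Fin n)} {w} (hw : IsEdgeWeight H w)
include hw

/-- All couplings between primal and dual variables are skew and cancel. -/
theorem inner_projField (Q : State n) :
    inner ℝ (projField A B w Q) Q = -dissipation A B w (projState Q) := by
  have hPT := sum_mdot_disagree_comm (projState Q).P Q.Theta hw
  have hUK := sum_mdot_disagree_comm Q.Ups Q.K hw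
  have hagent : ∀ i, mdot ((projField A B w Q).P i) (Q.P i) + (projField A B w Q).y i ⬝ᵥ Q.y i
      + (projField A B w Q).z i ⬝ᵥ Q.z i + mdot ((projField A B w Q).K i) (Q.K i)
      + (projField A B w Q).lam i ⬝ᵥ Q.lam i + mdot ((projField A B w Q).Theta i) (Q.Theta i)
      + mdot ((projField A B w Q).Ups i) (Q.Ups i)
      = -(((projState Q).P i *ᵥ A.col i - Q.y i) ⬝ᵥ ((projState Q).P i *ᵥ A.col i - Q.y i)
          + (B.col i ᵥ* (projState Q).P i - Q.z i) ⬝ᵥ (B.col i ᵥ* (projState Q).P i - Q.z i))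
        - mdot (disagree w (projState Q).P i) ((projState Q).P i)
        - mdot (disagree w Q.Ups i) (Q.Ups i)
        + (mdot (disagree w (projState Q).P i) (Q.Theta i)
          - mdot (disagree w Q.Theta i) ((projState Q).P i))
        + (mdot (disagree w Q.Ups i) (Q.K i) - mdot (disagree w Q.K i) (Q.Ups i)) := by
    intro i
    have hproj : projD (Q.P i) = (projState Q).P i := rfl
    have hy : (projState Q).y = Q.y := rfl
    have hz : (projState Q).z = Q.z := rfl
    have hK : (projState Q).K = Q.K := rfl
    have hlam : (projState Q).lam = Q.lam := rfl
    have hTheta : (projState Q).Theta = Q.Theta := rfl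
    have hUps : (projState Q).Ups = Q.Ups := rfl
    simp only [projField_apply, field, mdot_projD, hproj, hy, hz, hK, hlam, hTheta, hUps,
      mdot_sub_left, mdot_neg_left, mdot_vecMulVec_left, mdot_updateCol_zero,
      mdot_updateRow_zero, Matrix.dotProduct_mulVec (B.col i), sub_dotProduct,
      dotProduct_sub, add_dotProduct]
    linarith [dotProduct_comm (Q.y i) ((projState Q).P i *ᵥ A.col i),
      dotProduct_comm (Q.z i) (B.col i ᵥ* (projState Q).P i),
      dotProduct_comm (Q.lam i) (B.col i ᵥ* (projState Q).P i),
      dotProduct_comm (Q.lam i) (Q.z i),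
      dotProduct_comm ((Q.Ups i).col i) (Q.y i),
      dotProduct_comm ((Q.Ups i).row i) (Q.z i)]
  rw [inner_state, stateInner, Finset.sum_congr rfl fun i _ => hagent i]
  simp only [Finset.sum_add_distrib, Finset.sum_sub_distrib, Finset.sum_neg_distrib, dissipation,
    hPT, hUK]
  have hy : (projState Q).y = Q.y := rfl
  have hz : (projState Q).z = Q.z := rfl
  have hUps : (projState Q).Ups = Q.Ups := rfl
  rw [hy, hz, hUps]
  ring

theorem dissipation_nonneg (Q : State n) : 0 ≤ dissipation A B w Q :=
  add_nonneg (add_nonneg (Finset.sum_nonneg fun _ _ => add_nonneg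
    (dotProduct_self_nonneg_real _) (dotProduct_self_nonneg_real _))
    (sum_mdot_disagree_self_nonneg _ hw)) (sum_mdot_disagree_self_nonneg _ hw)

theorem of_dissipation_eq_zero {Q : State n} (h : dissipation A B w Q = 0) :
    (∀ i, Q.P i *ᵥ A.col i = Q.y i) ∧ (∀ i, B.col i ᵥ* Q.P i = Q.z i) ∧
      disagree w Q.P = 0 ∧ disagree w Q.Ups = 0 := by
  have hr := fun i => dotProduct_self_nonneg_real (Q.P i *ᵥ A.col i - Q.y i)
  have hs := fun i => dotProduct_self_nonneg_real (B.col i ᵥ* Q.P i - Q.z i)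
  have h1 := Finset.sum_nonneg fun i (_ : i ∈ Finset.univ) => add_nonneg (hr i) (hs i)
  have h2 := sum_mdot_disagree_self_nonneg Q.P hw
  have h3 := sum_mdot_disagree_self_nonneg Q.Ups hw
  rw [dissipation] at h
  have h4 := fun i => (Finset.sum_eq_zero_iff_of_nonneg
    (fun i _ => add_nonneg (hr i) (hs i))).1 (by linarith) i (Finset.mem_univ i)
  refine ⟨fun i => ?_, fun i => ?_, disagree_eq_zero _ hw (by linarith),
    disagree_eq_zero _ hw (by linarith)⟩
  · exact sub_eq_zero.1 (dotProduct_self_eq_zero.1 (by linarith [hr i, hs i, h4 i]))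
  · exact sub_eq_zero.1 (dotProduct_self_eq_zero.1 (by linarith [hr i, hs i, h4 i]))

/-- On an invariant subspace without dissipation the dynamics is nilpotent of order three:
the first step clears `λ`, `Θ`, `K`, the second `P` and with it `y`, `z`, the third `Υ`. -/
theorem projField_cube_eq_zero {N : Submodule ℝ (State n)}
    (hinv : ∀ Q ∈ N, projField A B w Q ∈ N)
    (hdiss : ∀ Q ∈ N, inner ℝ (projField A B w Q) Q = 0) {Q : State n} (hQ : Q ∈ N) :
    projField A B w (projField A B w (projField A B w Q)) = 0 := by
  have key : ∀ R ∈ N, (∀ i, projD (R.P i) *ᵥ A.col i = R.y i) ∧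
      (∀ i, B.col i ᵥ* projD (R.P i) = R.z i) ∧ disagree w (fun i => projD (R.P i)) = 0 ∧
      disagree w R.Ups = 0 := fun R hR =>
    of_dissipation_eq_zero A B hw (Q := projState R)
      (neg_eq_zero.1 ((inner_projField A B hw R).symm.trans (hdiss R hR)))
  have hD : ∀ R ∈ N, projField A B w R =
      { P := fun i => projD (-Matrix.vecMulVec (B.col i) (R.lam i) - disagree w R.Theta i)
        y := fun i => -(R.Ups i).col i
        z := fun i => R.lam i + (R.Ups i).row i
        K := 0
        lam := 0
        Theta := 0
        Ups := fun i => Matrix.updateCol 0 i (R.y i) - Matrix.updateRow 0 i (R.z i)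
          - disagree w R.K i } := by
    intro R hR
    obtain ⟨h1, h2, h3, h4⟩ := key R hR
    rw [projField_apply]
    ext1 <;> ext1 i <;> simp [field, projState, h1, h2, h3, h4]
  set R := projField A B w Q with hRdef
  have hR : R ∈ N := hinv Q hQ
  set S := projField A B w R with hSdef
  have hS : S ∈ N := hinv R hR
  have hRl : R.lam = 0 := by rw [hRdef, hD Q hQ]
  have hRT : R.Theta = 0 := by rw [hRdef, hD Q hQ]
  have hSP : ∀ i, S.P i = 0 := fun i => by
    rw [hSdef, hD R hR]
    simp [hRl, hRT, disagree_zero, projD_zero]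
  have hSK : S.K = 0 := by rw [hSdef, hD R hR]
  have hSl : S.lam = 0 := by rw [hSdef, hD R hR]
  have hST : S.Theta = 0 := by rw [hSdef, hD R hR]
  obtain ⟨hSy, hSz, -, -⟩ := key S hS
  have hT : projField A B w S ∈ N := hinv S hS
  have hTP : ∀ i, (projField A B w S).P i = 0 := fun i => by
    rw [hD S hS]
    simp [hSl, hST, disagree_zero, projD_zero]
  obtain ⟨hTy, hTz, -, -⟩ := key _ hT
  ext1
  · ext1 i; exact hTP i
  · ext1 i; rw [← hTy i, hTP i, projD_zero, Matrix.zero_mulVec]; rfl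
  · ext1 i; rw [← hTz i, hTP i, projD_zero, Matrix.vecMul_zero]; rfl
  · rw [hD S hS]; rfl
  · rw [hD S hS]; rfl
  · rw [hD S hS]; rfl
  · ext1 i
    rw [hD S hS]
    simp [← hSy, ← hSz, hSP, hSK, disagree_zero, projD_zero]

/-- Without dissipation the dynamics is skew on the subspace, and a nilpotent skew map vanishes. -/
theorem projField_eq_zero {N : Submodule ℝ (State n)}
    (hinv : ∀ Q ∈ N, projField A B w Q ∈ N)
    (hdiss : ∀ Q ∈ N, inner ℝ (projField A B w Q) Q = 0) {Q : State n} (hQ : Q ∈ N) :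
    projField A B w Q = 0 := by
  have hskew : ∀ R ∈ N, ∀ S ∈ N,
      inner ℝ (projField A B w R) S = -inner ℝ R (projField A B w S) := by
    intro R hR S hS
    have h := hdiss (R + S) (N.add_mem hR hS)
    rw [map_add, inner_add_left, inner_add_right, inner_add_right, hdiss R hR, hdiss S hS,
      real_inner_comm R] at h
    linarith
  have hR := hinv Q hQ
  have hS := hinv _ hR
  have h2 : projField A B w (projField A B w Q) = 0 := by
    rw [← inner_self_eq_zero (𝕜 := ℝ), hskew _ hR _ hS,
      projField_cube_eq_zero A B hw hinv hdiss hQ, inner_zero_right, neg_zero]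
  rw [← inner_self_eq_zero (𝕜 := ℝ), hskew _ hQ _ hR, h2, inner_zero_right, neg_zero]

end Dynamics

/-! ### Trajectories and equilibria -/

section Convergence

variable {n : ℕ} {A B : Matrix (Fin n) (Fin n) ℝ} {w : Fin n → Fin n → ℝ}

theorem exists_isTrajectory (Q₀ : State n) :
    ∃ Q : ℝ → State n, IsTrajectory A B w Q ∧ Q 0 = Q₀ := by
  obtain ⟨Q, hQ, hQ0⟩ :=
    exists_hasDerivWithinAt (LinearMap.toContinuousLinearMap (fieldLin A B w)) Q₀
  exact ⟨Q, isTrajectory_iff.2 hQ, hQ0⟩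

/-- `P ↦ P 1` annihilates the projected velocities, so row sums are conserved. -/
theorem IsTrajectory.mulVec_one {Q : ℝ → State n} (hQ : IsTrajectory A B w Q) (i : Fin n) {t : ℝ}
    (ht : 0 ≤ t) : (Q t).P i *ᵥ (fun _ => 1) = (Q 0).P i *ᵥ (fun _ => 1) := by
  ext k
  have hderiv : ∀ s, 0 ≤ s →
      HasDerivWithinAt (fun s => ∑ l, (Q s).P i k l) 0 (Ici 0) s := by
    intro s hs
    have h := HasDerivWithinAt.fun_sum fun l (_ : l ∈ Finset.univ) => hQ.P s hs i k l
    have h0 : ∑ l, (field A B w (Q s)).P i k l = 0 := by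
      have := congrFun (projD_mulVec_one (-Matrix.vecMulVec ((Q s).P i *ᵥ A.col i - (Q s).y i)
        (A.col i) - Matrix.vecMulVec (B.col i) ((Q s).lam i) - disagree w (Q s).Theta i
        - disagree w (Q s).P i - Matrix.vecMulVec (B.col i) (B.col i ᵥ* (Q s).P i - (Q s).z i))) k
      simp only [Matrix.mulVec, dotProduct, mul_one] at this
      exact this
    rwa [h0] at h
  have h := constant_of_has_deriv_right_zero (f := fun s => ∑ l, (Q s).P i k l) (a := 0) (b := t)
    (fun s hs => (hderiv s hs.1).continuousWithinAt.mono Icc_subset_Ici_self)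
    (fun s hs => (hderiv s hs.1).mono (Ici_subset_Ici.2 hs.1)) t ⟨ht, le_rfl⟩
  simpa only [Matrix.mulVec, dotProduct, mul_one] using h

theorem sum_updateCol_mulVec (P A : Matrix (Fin n) (Fin n) ℝ) :
    ∑ i, Matrix.updateCol 0 i (P *ᵥ A.col i) = P * A := by
  ext k l
  simp [Matrix.sum_apply, Matrix.updateCol_apply, Matrix.mul_apply, Matrix.mulVec, dotProduct]

theorem sum_updateRow_vecMul {B : Matrix (Fin n) (Fin n) ℝ} (hB : B.IsSymm)
    (P : Matrix (Fin n) (Fin n) ℝ) :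
    ∑ i, Matrix.updateRow 0 i (B.col i ᵥ* P) = B * P := by
  ext k l
  simp only [Matrix.sum_apply, Matrix.updateRow_apply, Matrix.mul_apply, Matrix.vecMul, dotProduct,
    Matrix.col_apply]
  rw [Finset.sum_eq_single k (by simp +contextual [eq_comm]) (by simp)]
  simp [hB.apply]

variable {G₁ G₂ : WeightedGraph n} {H : SimpleGraph (Fin n)} {M : Matrix (Fin n) (Fin n) ℝ}

/-- At an isomorphism `M` the auxiliary variables `K` can be chosen to balance the columns of `M A`
against the rows of `B M`, as the two matrices agree. -/
theorem exists_isEquilibrium (hw : IsEdgeWeight H w) (hH : H.Connected)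
    (hM : M ∈ WeightedGraph.isoSet G₁ G₂) :
    ∃ Q, IsEquilibrium G₁.adj G₂.adj w Q ∧ ∀ i, Q.P i = M := by
  obtain ⟨K, hK⟩ := exists_disagree_eq hw hH
    (fun i => Matrix.updateCol 0 i (M *ᵥ G₁.adj.col i)
      - Matrix.updateRow 0 i (G₂.adj.col i ᵥ* M)) (by
    rw [Finset.sum_sub_distrib, sum_updateCol_mulVec, sum_updateRow_vecMul G₂.symm,
      WeightedGraph.mul_adj_of_mem_isoSet hM, sub_self])
  refine ⟨⟨fun _ => M, fun i => M *ᵥ G₁.adj.col i, fun i => G₂.adj.col i ᵥ* M, K, 0, 0, 0⟩, ?_,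
    fun _ => rfl⟩
  rw [IsEquilibrium]
  ext1 <;> ext1 i <;> simp [field, disagree_const, disagree_zero, hK, projD_zero]
  · rfl
  · rfl

/-- In an equilibrium with `Pᵢ 1 = 0` the agents agree on a matrix `P`; summing the equations of the
`Υᵢ` over the agents cancels `K` and leaves `P A = B P`, which friendliness excludes. -/
theorem P_eq_zero_of_field_eq_zero (hw : IsEdgeWeight H w) (hH : H.Connected)
    (hf : G₁.Friendly) (hM : M ∈ WeightedGraph.isoSet G₁ G₂) {Q : State n}
    (hQ : field G₁.adj G₂.adj w Q = 0) (hQ1 : ∀ i, Q.P i *ᵥ (fun _ => 1) = 0) : Q.P = 0 := by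
  have hproj := projState_eq_self hQ1
  have hdiss : dissipation G₁.adj G₂.adj w Q = 0 := by
    have h := inner_projField G₁.adj G₂.adj hw Q
    rw [projField_apply, hproj, hQ, inner_zero_left] at h
    linarith
  obtain ⟨hy, hz, hP, hU⟩ := of_dissipation_eq_zero _ _ hw hdiss
  have hPeq := eq_of_disagree_eq_zero Q.P hw hH hP
  obtain ⟨i₀⟩ := hH.nonempty
  have hUps : ∑ i, (Matrix.updateCol 0 i (Q.y i) - Matrix.updateRow 0 i (Q.z i)
      - disagree w Q.K i - disagree w Q.Ups i) = 0 :=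
    Finset.sum_eq_zero fun i _ => congrFun (congrArg State.Ups hQ) i
  simp only [Finset.sum_sub_distrib, sum_disagree _ hw, sub_zero, ← hy, ← hz,
    fun i => hPeq i i₀] at hUps
  rw [sum_updateCol_mulVec, sum_updateRow_vecMul G₂.symm, sub_eq_zero] at hUps
  have h0 := hf.eq_zero_of_intertwine hM hUps (hQ1 i₀)
  ext1 i
  rw [hPeq i i₀, h0]
  rfl

theorem exists_convergesTo (hw : IsEdgeWeight H w) (hH : H.Connected)
    (hf : G₁.Friendly) (hM : M ∈ WeightedGraph.isoSet G₁ G₂) {Q : ℝ → State n}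
    (hQ : IsTrajectory G₁.adj G₂.adj w Q) (hQ0 : ∀ i, (Q 0).P i ∈ pseudoStochastic n) :
    ∃ Qe, IsEquilibrium G₁.adj G₂.adj w Qe ∧ (∀ i, Qe.P i = M) ∧ ConvergesTo Q Qe := by
  obtain ⟨Qe, hQe, hQeM⟩ := exists_isEquilibrium hw hH hM
  have hQe' : fieldLin G₁.adj G₂.adj w Qe = 0 := hQe
  have hrow : ∀ t, 0 ≤ t → ∀ i, (Q t - Qe).P i *ᵥ (fun _ => 1) = 0 := by
    intro t ht i
    rw [State.sub_P, Pi.sub_apply, Matrix.sub_mulVec, hQ.mulVec_one i ht, hQ0 i, hQeM,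
      hM.1.2.1, sub_self]
  obtain ⟨p, hp, hlim⟩ := exists_tendsto_of_dissipative (D := projField G₁.adj G₂.adj w)
    (fun v => by
      rw [inner_projField _ _ hw]
      exact neg_nonpos.2 (dissipation_nonneg _ _ hw _))
    (fun N hinv hdiss v => projField_eq_zero _ _ hw hinv hdiss)
    (x := fun t => Q t - Qe) fun t ht => by
      rw [projField_apply, projState_eq_self (hrow t ht), ← fieldLin_apply, map_sub, hQe',
        sub_zero]
      exact (isTrajectory_iff.1 hQ t ht).sub_const Qe
  have hpc := convergesTo_of_tendsto hlim
  have hp1 : ∀ i, p.P i *ᵥ (fun _ => 1) = 0 := by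
    intro i
    have h : Tendsto (fun t => (Q t - Qe).P i *ᵥ (fun _ => (1 : ℝ))) atTop
        (𝓝 (p.P i *ᵥ (fun _ => 1))) :=
      ((continuous_id.matrix_mulVec continuous_const).tendsto (p.P i)).comp
        ((continuous_apply i).tendsto p.P |>.comp hpc.P)
    refine tendsto_nhds_unique h (tendsto_const_nhds.congr' ?_)
    filter_upwards [eventually_ge_atTop 0] with t ht using (hrow t ht i).symm
  have hp' : fieldLin G₁.adj G₂.adj w p = 0 := by
    rwa [projField_apply, projState_eq_self hp1] at hp
  have hpP := P_eq_zero_of_field_eq_zero hw hH hf hM hp' hp1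
  refine ⟨p + Qe, ?_, fun i => ?_, ?_⟩
  · change fieldLin G₁.adj G₂.adj w (p + Qe) = 0
    rw [map_add, hp', hQe', add_zero]
  · rw [State.add_P, hpP, zero_add, hQeM]
  · refine convergesTo_of_tendsto ?_
    simpa using hlim.add_const Qe

end Convergence

end GraphMatching

theorem theorem2 {n : ℕ} (G₁ G₂ : GraphMatching.WeightedGraph n)
    (hfriendly : G₁.Friendly) (hiso : G₁.Isomorphic G₂)
    (H : SimpleGraph (Fin n)) (hH : H.Connected)
    (w : Fin n → Fin n → ℝ) (hw : GraphMatching.IsEdgeWeight H w) :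
    ∃ Pstar : Matrix (Fin n) (Fin n) ℝ,
      GraphMatching.WeightedGraph.isoSet G₁ G₂ = {Pstar} ∧
      ∀ Q₀ : GraphMatching.State n, (∀ i, Q₀.P i ∈ GraphMatching.pseudoStochastic n) →
        (∃ Q : ℝ → GraphMatching.State n,
          GraphMatching.IsTrajectory G₁.adj G₂.adj w Q ∧ Q 0 = Q₀) ∧
        ∀ Q : ℝ → GraphMatching.State n,
          GraphMatching.IsTrajectory G₁.adj G₂.adj w Q → Q 0 = Q₀ →
          (∃ Qe : GraphMatching.State n,
            GraphMatching.IsEquilibrium G₁.adj G₂.adj w Qe ∧ GraphMatching.ConvergesTo Q Qe) ∧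
          (∀ i, Tendsto (fun t => (Q t).P i) atTop (𝓝 Pstar)) ∧
          (∃ T : ℝ, 0 < T ∧ ∀ t, T ≤ t → ∀ i, GraphMatching.frob ((Q t).P i - Pstar) < 1 / 2 ∧
            GraphMatching.permProj ((Q t).P i) = {Pstar} ∧
            GraphMatching.nearestPerm ((Q t).P i) = {Pstar}) ∧
          (∀ t, 0 ≤ t → ∀ i, GraphMatching.frob ((Q t).P i - Pstar) < 1 / 2 →
            GraphMatching.permProj ((Q t).P i) = {Pstar} ∧
            GraphMatching.nearestPerm ((Q t).P i) = {Pstar}) := by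
  obtain ⟨M, hM⟩ := hiso
  refine ⟨M, hfriendly.isoSet_eq_singleton hM, fun Q₀ hQ₀ =>
    ⟨GraphMatching.exists_isTrajectory Q₀, fun Q hQ hQ0 => ?_⟩⟩
  have hproj : ∀ t i, GraphMatching.frob ((Q t).P i - M) < 1 / 2 →
      GraphMatching.permProj ((Q t).P i) = {M} ∧
      GraphMatching.nearestPerm ((Q t).P i) = {M} := fun t i h => by
    rw [GraphMatching.nearestPerm_eq_permProj, and_self]
    exact GraphMatching.permProj_eq_singleton hM.1 h
  obtain ⟨Qe, hQe, hQeM, hconv⟩ :=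
    GraphMatching.exists_convergesTo hw hH hfriendly hM hQ (by rwa [hQ0])
  have hlim : ∀ i, Tendsto (fun t => (Q t).P i) atTop (𝓝 M) := fun i => by
    have h := ((continuous_apply i).tendsto Qe.P).comp hconv.P
    rwa [hQeM] at h
  refine ⟨⟨Qe, hQe, hconv⟩, hlim, ?_, fun t _ i => hproj t i⟩
  have hev : ∀ i, ∀ᶠ t in atTop, GraphMatching.frob ((Q t).P i - M) < 1 / 2 := by
    intro i
    have hcont : Continuous fun X : Matrix (Fin n) (Fin n) ℝ => GraphMatching.frob (X - M) := by
      unfold GraphMatching.frob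
      fun_prop
    have h := (hcont.tendsto M).comp (hlim i)
    refine h.eventually (gt_mem_nhds ?_)
    rw [sub_self, GraphMatching.frob_eq_zero.2 rfl]
    norm_num
  obtain ⟨T, hT⟩ := eventually_atTop.1 (eventually_all.2 hev)
  refine ⟨max T 1, lt_max_of_lt_right one_pos, fun t ht i => ?_⟩
  have h := hT t ((le_max_left _ _).trans ht) i
  exact ⟨h, hproj t i h⟩
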